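/- Let $1<p<\infty$, let $I\subset\mathbb R$ be a nondegenerate (not necessarily open or bounded) interval, and let $\mu$ be a measure with $d\mu=w\,dx$ on $I$, where $w\ge 0$ and both $w$ and $w^{1/(1-p)}$ (with $0^{1/(1-p)}=\infty$) belong to $L^1_{\rm loc}(I)$. Here a local property on $I$ means that each $x\in I$ has some $r>0$ such that the property holds on $I\cap(x-r,x+r)$, regarded as a metric space with the restriction of $\mu$ (or of Lebesgue measure, for the conditions on $w$). For such a metric space $E\subset\mathbb R$, curves in $E$ are nonconstant, compact, rectifiable and parametrized by arc length, $\gamma:[0,l]\to E$. A Borel function $g:E\to[0,\infty]$ is an upper gradient of $u:E\to[-\infty,\infty]$ if $$|u(\gamma(0))-u(\gamma(l))|\le\int_\gamma g\,ds$$ for every curve $\gamma$ in $E$, the left-hand side being $\infty$ if $u(\gamma(0))$ or $u(\gamma(l))$ is $\pm\infty$. A $\mu$-measurable $g:E\to[0,\infty]$ is a $p$-weak upper gradient of $u$ if there is a Borel function $\rho:E\to[0,\infty]$ in $L^p(E,\mu)$ such that $\int_\gamma\rho\,ds=\infty$ for every curve $\gamma$ in $E$ for which the inequality fails. A minimal $p$-weak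 upper gradient $g_u$ of $u$ is a $p$-weak upper gradient in $L^p_{\rm loc}(E,\mu)$ such that $g_u\le g$ $\mu$-a.e. for every $p$-weak upper gradient $g\in L^p_{\rm loc}(E,\mu)$ of $u$. The space $N^{1,p}(E,\mu)$ consists of all $\mu$-measurable $u:E\to[-\infty,\infty]$ with $\int_E|u|^p\,d\mu<\infty$ that have an upper gradient in $L^p(E,\mu)$, and $N^{1,p}_{\rm loc}(I,\mu)$ is the corresponding local space. Then every $u\in N^{1,p}_{\rm loc}(I,\mu)$ is real-valued and locally absolutely continuous on $I$ (that is, absolutely continuous on each compact subinterval of $I$), and hence differentiable a.e. on $I$. Moreover, $|u'|$ is a minimal $p$-weak upper gradient of $u$ on $I$, and every minimal $p$-weak upper gradient $g_u$ of $u$ on $I$ satisfies $g_u=|u'|$ a.e. on $I$. -/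

import Mathlib

open MeasureTheory Set
open scoped ENNReal

namespace NewtonianSpace

section MetricMeasure

variable {X : Type*} [MetricSpace X] [MeasurableSpace X]

/-! Throughout, a subset `E` of the metric space `X` is regarded as a metric space in its own
right (with the induced metric and the restricted measure); only the values of functions on `E`
matter, and the ball of `E` with centre `x ∈ E` and radius `r` is `Metric.ball x r ∩ E`. -/

/-- `γ : [0, l] → E` is a nonconstant compact rectifiable curve in `E`, parametrized by arc length
(`HasUnitSpeedOn` says that the length of `γ` over `[s, t]` is `t - s`, so `γ` is `1`-Lipschitz,
in particular continuous, on `[0, l]`, and `l` is its length). -/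
def IsCurveIn (E : Set X) (γ : ℝ → X) (l : ℝ) : Prop :=
  0 < l ∧ MapsTo γ (Icc 0 l) E ∧ HasUnitSpeedOn γ (Icc 0 l)

/-- The integral of `g` along the arc-length parametrized curve `γ : [0, l] → X`. -/
noncomputable def arcIntegral (g : X → ℝ≥0∞) (γ : ℝ → X) (l : ℝ) : ℝ≥0∞ :=
  ∫⁻ t in Icc 0 l, g (γ t)

/-- The upper gradient inequality `|u(γ(0)) - u(γ(l))| ≤ ∫_γ g ds`. In `EReal`, a difference in
which at least one term is infinite is always `⊤` or `⊥` (also `⊤ - ⊤ = ⊥ - ⊥ = ⊥`), so its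
absolute value is `∞`, which is the usual convention for the left-hand side. -/
def UpperGradientIneq (u : X → EReal) (g : X → ℝ≥0∞) (γ : ℝ → X) (l : ℝ) : Prop :=
  (u (γ 0) - u (γ l)).abs ≤ arcIntegral g γ l

/-- `g` is an upper gradient of `u` on `E`. -/
def IsUpperGradientOn (u : X → EReal) (g : X → ℝ≥0∞) (E : Set X) : Prop :=
  Measurable (E.domRestrict g) ∧
    ∀ (γ : ℝ → X) (l : ℝ), IsCurveIn E γ l → UpperGradientIneq u g γ l

/-- `g ∈ L^p(E, μ)`, for nonnegative extended real-valued `g`. -/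
def MemLpOn (g : X → ℝ≥0∞) (p : ℝ) (μ : Measure X) (E : Set X) : Prop :=
  MemLp g (ENNReal.ofReal p) (μ.restrict E)

/-- `g ∈ L^p_loc(E, μ)`: every point of `E` is the centre of a ball of `E` on which `g` is
in `L^p`. -/
def MemLpLocOn (g : X → ℝ≥0∞) (p : ℝ) (μ : Measure X) (E : Set X) : Prop :=
  ∀ x ∈ E, ∃ r > 0, MemLpOn g p μ (Metric.ball x r ∩ E)

/-- The property `P γ l` holds for `p`-almost every curve in `E`: there is a nonnegative Borel
function `ρ ∈ L^p(E, μ)` with `∫_γ ρ ds = ∞` for every curve for which it fails. -/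
def ForPAlmostEveryCurve (p : ℝ) (μ : Measure X) (E : Set X) (P : (ℝ → X) → ℝ → Prop) : Prop :=
  ∃ ρ : X → ℝ≥0∞, Measurable (E.domRestrict ρ) ∧ MemLpOn ρ p μ E ∧
    ∀ (γ : ℝ → X) (l : ℝ), IsCurveIn E γ l → ¬ P γ l → arcIntegral ρ γ l = ∞

/-- `g` is a `p`-weak upper gradient of `u` on `E` (here `g` is only measurable with respect to
the completion of `μ`). -/
def IsPWeakUpperGradientOn (u : X → EReal) (g : X → ℝ≥0∞) (p : ℝ) (μ : Measure X)
    (E : Set X) : Prop :=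
  AEMeasurable g (μ.restrict E) ∧ ForPAlmostEveryCurve p μ E (UpperGradientIneq u g)

/-- `g` is a minimal `p`-weak upper gradient of `u` on `E`. -/
def IsMinimalPWeakUpperGradientOn (u : X → EReal) (g : X → ℝ≥0∞) (p : ℝ) (μ : Measure X)
    (E : Set X) : Prop :=
  IsPWeakUpperGradientOn u g p μ E ∧ MemLpLocOn g p μ E ∧
    ∀ g' : X → ℝ≥0∞, IsPWeakUpperGradientOn u g' p μ E → MemLpLocOn g' p μ E →
      ∀ᵐ x ∂(μ.restrict E), g x ≤ g' x

/-- `u ∈ N^{1,p}(E, μ)`: `u` is measurable (with respect to the completion of `μ`), `|u|` is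
`p`-integrable, and `u` has an upper gradient in `L^p(E, μ)`. The last condition makes the
gradient part of the Newtonian norm finite. -/
def MemNewtonian (u : X → EReal) (p : ℝ) (μ : Measure X) (E : Set X) : Prop :=
  AEMeasurable u (μ.restrict E) ∧ MemLpOn (fun x => (u x).abs) p μ E ∧
    ∃ g : X → ℝ≥0∞, IsUpperGradientOn u g E ∧ MemLpOn g p μ E

/-- `u ∈ N^{1,p}_loc(E, μ)`: every point of `E` is the centre of a ball of `E` on which `u` is
in `N^{1,p}`. -/
def MemNewtonianLoc (u : X → EReal) (p : ℝ) (μ : Measure X) (E : Set X) : Prop :=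
  ∀ x ∈ E, ∃ r > 0, MemNewtonian u p μ (Metric.ball x r ∩ E)

end MetricMeasure

/-- `v` is locally absolutely continuous on the interval `I`: it is absolutely continuous on every
compact subinterval of `I`. -/
def LocallyAbsolutelyContinuousOn (v : ℝ → ℝ) (I : Set ℝ) : Prop :=
  ∀ a b : ℝ, a ≤ b → Icc a b ⊆ I → AbsolutelyContinuousOnInterval v a b

end NewtonianSpace

open Filter Topology

theorem ae_restrict_of_forall_nhdsWithin {ν : Measure ℝ} {I : Set ℝ} (hI : MeasurableSet I)
    {P : ℝ → Prop} (h : ∀ x ∈ I, ∃ t ∈ 𝓝[I] x, ∀ᵐ y ∂(ν.restrict t), P y) :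
    ∀ᵐ y ∂(ν.restrict I), P y := by
  rw [ae_restrict_iff' hI, ae_iff]
  refine measure_null_of_locally_null _ fun x hx => ?_
  have hx' : x ∈ I ∧ ¬ P x := by simpa using hx
  obtain ⟨t, ht, hP⟩ := h x hx'.1
  refine ⟨{y | ¬ (y ∈ I → P y)} ∩ t, inter_mem self_mem_nhdsWithin
    (nhdsWithin_mono _ (fun y hy => ?_) ht), ?_⟩
  · have : y ∈ I ∧ ¬ P y := by simpa using hy
    exact this.1
  · refine measure_mono_null ?_ (le_antisymm ((Measure.le_restrict_apply t {y | ¬ P y}).trans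
      (ae_iff.1 hP).le) bot_le)
    rintro y ⟨hy, hyt⟩
    have : y ∈ I ∧ ¬ P y := by simpa using hy
    exact ⟨this.2, hyt⟩

theorem Set.OrdConnected.exists_Icc_mem_nhdsWithin {I : Set ℝ} (hI : I.OrdConnected)
    (hI' : I.Nontrivial) {x : ℝ} (hx : x ∈ I) {t : Set ℝ} (ht : t ∈ 𝓝[I] x) :
    ∃ a b, a < b ∧ x ∈ Icc a b ∧ Icc a b ⊆ I ∧ Icc a b ⊆ t ∧ Icc a b ∈ 𝓝[I] x := by
  obtain ⟨r, hr, hrt⟩ := Metric.mem_nhdsWithin_iff.1 ht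
  have hleft : ∃ a ∈ I, a ≤ x ∧ x - r < a ∧ Ici a ∈ 𝓝[I] x ∧ ((∃ y ∈ I, y < x) → a < x) := by
    by_cases h : ∃ y ∈ I, y < x
    · obtain ⟨y, hy, hyx⟩ := h
      refine ⟨max y (x - r / 2), hI.out hy hx ⟨le_max_left _ _, max_le hyx.le (by linarith)⟩,
        max_le hyx.le (by linarith), lt_max_of_lt_right (by linarith),
        mem_nhdsWithin_of_mem_nhds (Ici_mem_nhds (max_lt hyx (by linarith))),
        fun _ => max_lt hyx (by linarith)⟩
    · refine ⟨x, hx, le_rfl, by linarith, ?_, fun h' => absurd h' h⟩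
      push Not at h
      exact mem_of_superset self_mem_nhdsWithin fun y hy => h y hy
  have hright : ∃ b ∈ I, x ≤ b ∧ b < x + r ∧ Iic b ∈ 𝓝[I] x ∧ ((∃ y ∈ I, x < y) → x < b) := by
    by_cases h : ∃ y ∈ I, x < y
    · obtain ⟨y, hy, hyx⟩ := h
      refine ⟨min y (x + r / 2), hI.out hx hy ⟨le_min hyx.le (by linarith), min_le_left _ _⟩,
        le_min hyx.le (by linarith), min_lt_of_right_lt (by linarith),
        mem_nhdsWithin_of_mem_nhds (Iic_mem_nhds (lt_min hyx (by linarith))),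
        fun _ => lt_min hyx (by linarith)⟩
    · refine ⟨x, hx, le_rfl, by linarith, ?_, fun h' => absurd h' h⟩
      push Not at h
      exact mem_of_superset self_mem_nhdsWithin fun y hy => h y hy
  obtain ⟨a, haI, hax, har, ha, ha'⟩ := hleft
  obtain ⟨b, hbI, hxb, hbr, hb, hb'⟩ := hright
  have hsub : Icc a b ⊆ I := hI.out haI hbI
  refine ⟨a, b, ?_, ⟨hax, hxb⟩, hsub, fun y hy => hrt ⟨?_, hsub hy⟩, inter_mem ha hb⟩
  · obtain ⟨y, hy, hyx⟩ := hI'.exists_ne x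
    rcases lt_or_gt_of_ne hyx with h | h
    · exact (ha' ⟨y, hy, h⟩).trans_le hxb
    · exact hax.trans_lt (hb' ⟨y, hy, h⟩)
  · rw [Metric.mem_ball, Real.dist_eq, abs_lt]
    constructor <;> linarith [hy.1, hy.2]

theorem AbsolutelyContinuousOnInterval.of_dist_le {X Y : Type*} [PseudoMetricSpace X]
    [PseudoMetricSpace Y] {v : ℝ → X} {F : ℝ → Y} {a b : ℝ}
    (hF : AbsolutelyContinuousOnInterval F a b)
    (h : ∀ x ∈ uIcc a b, ∀ y ∈ uIcc a b, dist (v x) (v y) ≤ dist (F x) (F y)) :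
    AbsolutelyContinuousOnInterval v a b := by
  unfold AbsolutelyContinuousOnInterval at hF ⊢
  refine tendsto_of_tendsto_of_tendsto_of_le_of_le' tendsto_const_nhds hF
    (Eventually.of_forall fun E => Finset.sum_nonneg fun _ _ => dist_nonneg) ?_
  refine mem_inf_of_right (mem_principal.2 fun E hE => ?_)
  change (_ : ℝ) ≤ _
  refine Finset.sum_le_sum fun i hi => ?_
  exact h _ (hE.1 i hi).1 _ (hE.1 i hi).2

theorem AbsolutelyContinuousOnInterval.trans {v : ℝ → ℝ} {a b c : ℝ} (hab : a ≤ b) (hbc : b ≤ c)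
    (h₁ : AbsolutelyContinuousOnInterval v a b) (h₂ : AbsolutelyContinuousOnInterval v b c) :
    AbsolutelyContinuousOnInterval v a c := by
  have hint := h₁.intervalIntegrable_deriv.trans h₂.intervalIntegrable_deriv
  have key : ∀ x ∈ Icc a c, v x = v a + ∫ t in a..x, deriv v t := by
    intro x hx
    rcases le_total x b with hxb | hbx
    · have := (h₁.mono (c := a) (d := x) (by
        rw [uIcc_of_le hab, uIcc_of_le hx.1]; exact Icc_subset_Icc_right hxb)).integral_deriv_eq_sub
      linarith
    · have h₃ := h₂.mono (c := b) (d := x) (by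
        rw [uIcc_of_le hbc, uIcc_of_le hbx]; exact Icc_subset_Icc_right hx.2)
      have e₁ := h₁.integral_deriv_eq_sub
      have e₂ := h₃.integral_deriv_eq_sub
      have := intervalIntegral.integral_add_adjacent_intervals h₁.intervalIntegrable_deriv
        h₃.intervalIntegrable_deriv
      linarith
  refine (hint.absolutelyContinuousOnInterval_intervalIntegral (c := a) left_mem_uIcc).of_dist_le ?_
  rw [uIcc_of_le (hab.trans hbc)]
  intro x hx y hy
  rw [key x hx, key y hy, dist_add_left]

theorem AbsolutelyContinuousOnInterval.of_forall_nhdsWithin {v : ℝ → ℝ} {I : Set ℝ}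
    (h : ∀ x ∈ I, ∃ a b, a ≤ b ∧ Icc a b ∈ 𝓝[I] x ∧ AbsolutelyContinuousOnInterval v a b)
    {c d : ℝ} (hcd : c ≤ d) (hI : Icc c d ⊆ I) : AbsolutelyContinuousOnInterval v c d := by
  have h' : ∀ x : Icc c d, ∃ U : Set (Icc c d), IsOpen U ∧ x ∈ U ∧
      ∃ a b, a ≤ b ∧ AbsolutelyContinuousOnInterval v a b ∧ ∀ y ∈ U, (y : ℝ) ∈ Icc a b := by
    intro x
    obtain ⟨a, b, hab, hx, hv⟩ := h x (hI x.2)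
    obtain ⟨U, hU, hxU, hUs⟩ := mem_nhdsWithin.1 hx
    exact ⟨Subtype.val ⁻¹' U, hU.preimage continuous_subtype_val, hxU, a, b, hab, hv,
      fun y hy => hUs ⟨hy, hI y.2⟩⟩
  choose U hUo hxU a b hab hv hU using h'
  obtain ⟨t, ht0, htm, ⟨m, hm⟩, ht⟩ := exists_monotone_Icc_subset_open_cover_Icc hcd hUo
    (fun x _ => mem_iUnion.2 ⟨x, hxU x⟩)
  have step : ∀ n, AbsolutelyContinuousOnInterval v c (t n) := by
    intro n
    induction n with
    | zero =>
      have hrefl : AbsolutelyContinuousOnInterval v c c :=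
        AbsolutelyContinuousOnInterval.mono (hv ⟨c, left_mem_Icc.2 hcd⟩) (by
          rw [uIcc_self, singleton_subset_iff, uIcc_of_le (hab _)]
          exact hU _ _ (hxU ⟨c, left_mem_Icc.2 hcd⟩))
      rw [ht0]
      exact hrefl
    | succ n ih =>
      obtain ⟨i, hi⟩ := ht n
      have hle : t n ≤ t (n + 1) := htm n.le_succ
      refine ih.trans (t n).2.1 hle ((hv i).mono ?_)
      rw [uIcc_of_le (show (t n : ℝ) ≤ t (n + 1) from hle), uIcc_of_le (hab i)]
      exact Icc_subset_Icc (hU i _ (hi (left_mem_Icc.2 hle))).1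
        (hU i _ (hi (right_mem_Icc.2 hle))).2
  have := step m
  rwa [hm m le_rfl] at this

/-- A function whose increments are bounded by the integrals of an integrable function is
absolutely continuous, with derivative bounded by that function. -/
theorem absolutelyContinuousOnInterval_and_enorm_deriv_le {v : ℝ → ℝ} {g : ℝ → ℝ≥0∞} {a b : ℝ}
    (hab : a ≤ b) (hg : AEMeasurable g (volume.restrict (Icc a b)))
    (hgi : ∫⁻ x in Icc a b, g x ≠ ∞)
    (h : ∀ x ∈ Icc a b, ∀ y ∈ Icc a b, x < y →
      ENNReal.ofReal |v x - v y| ≤ ∫⁻ t in Icc x y, g t) :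
    AbsolutelyContinuousOnInterval v a b ∧
      ∀ᵐ x ∂(volume.restrict (Icc a b)), ‖deriv v x‖ₑ ≤ g x := by
  have hint : IntervalIntegrable (fun x => (g x).toReal) volume a b :=
    (intervalIntegrable_iff_integrableOn_Icc_of_le hab).2
      (integrable_toReal_of_lintegral_ne_top hg hgi)
  have hfin := ae_lt_top' hg hgi
  set F : ℝ → ℝ := fun x => ∫ t in a..x, (g t).toReal with hF
  have key : ∀ x ∈ Icc a b, ∀ y ∈ Icc a b, x ≤ y → |v x - v y| ≤ F y - F x := by
    intro x hx y hy hxy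
    rcases hxy.eq_or_lt with rfl | hlt
    · simp
    have hsub : Icc x y ⊆ Icc a b := Icc_subset_Icc hx.1 hy.2
    have h1 : F y - F x = (∫⁻ t in Icc x y, g t).toReal := by
      rw [hF, intervalIntegral.integral_interval_sub_left, intervalIntegral.integral_of_le hxy,
        ← integral_Icc_eq_integral_Ioc, integral_toReal]
      · exact hg.mono_set hsub
      · exact ae_mono (Measure.restrict_mono hsub le_rfl) hfin
      · exact hint.mono_set (by
          rw [uIcc_of_le hab, uIcc_of_le hy.1]; exact Icc_subset_Icc_right hy.2)
      · exact hint.mono_set (by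
          rw [uIcc_of_le hab, uIcc_of_le hx.1]; exact Icc_subset_Icc_right hx.2)
    rw [h1]
    refine (ENNReal.ofReal_le_iff_le_toReal ?_).1 (h x hx y hy hlt)
    exact ne_top_of_le_ne_top hgi (lintegral_mono_set hsub)
  have hFac : AbsolutelyContinuousOnInterval F a b :=
    hint.absolutelyContinuousOnInterval_intervalIntegral left_mem_uIcc
  refine ⟨hFac.of_dist_le ?_, ?_⟩
  · rw [uIcc_of_le hab]
    intro x hx y hy
    rw [Real.dist_eq, Real.dist_eq]
    rcases le_total x y with hxy | hxy
    · exact (key x hx y hy hxy).trans ((le_abs_self _).trans (abs_sub_comm _ _).le)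
    · rw [abs_sub_comm]
      exact (key y hy x hx hxy).trans (le_abs_self _)
  · rw [Measure.restrict_congr_set Ioo_ae_eq_Icc.symm] at hfin ⊢
    have hd := ae_restrict_of_ae (s := Ioo a b) hint.ae_hasDerivAt_integral
    filter_upwards [hfin, hd, ae_restrict_mem measurableSet_Ioo] with x hgx hx hxab
    have hFx : HasDerivAt F (g x).toReal x :=
      hx (by rw [uIcc_of_le hab]; exact Ioo_subset_Icc_self hxab) a left_mem_uIcc
    by_cases hv : DifferentiableAt ℝ v x
    swap
    · simp [deriv_zero_of_not_differentiableAt hv]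
    have hbound : |deriv v x| ≤ (g x).toReal := by
      have h1 := (hv.hasDerivAt.tendsto_slope).abs
      have h2 := hFx.tendsto_slope
      refine le_of_tendsto_of_tendsto h1 h2 ?_
      filter_upwards [mem_nhdsWithin_of_mem_nhds (Icc_mem_nhds hxab.1 hxab.2),
        self_mem_nhdsWithin] with y hy hyx
      have hx' := Ioo_subset_Icc_self hxab
      rw [slope_def_field, slope_def_field, abs_div]
      rcases lt_or_gt_of_ne hyx with hlt | hlt
      · rw [abs_of_neg (sub_neg.2 hlt), ← neg_div_neg_eq (F y - F x)]
        gcongr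
        · linarith
        · linarith [key y hy x hx' hlt.le]
      · rw [abs_of_pos (sub_pos.2 hlt)]
        gcongr
        rw [abs_sub_comm]
        exact key x hx' y hy hlt.le
    rw [Real.enorm_eq_ofReal_abs, ← ENNReal.ofReal_toReal hgx.ne]
    exact ENNReal.ofReal_le_ofReal hbound

/-- The change of variables inequality for a curve of speed at most one. -/
theorem LipschitzOnWith.setLIntegral_uIcc_le {γ : ℝ → ℝ} {l : ℝ} (hl : 0 ≤ l)
    (hγ : LipschitzOnWith 1 γ (Icc 0 l)) {h : ℝ → ℝ≥0∞} (hh : Measurable h) :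
    ∫⁻ x in uIcc (γ 0) (γ l), h x ≤ ∫⁻ t in Icc 0 l, h (γ t) := by
  have hγm : AEMeasurable γ (volume.restrict (Icc 0 l)) :=
    hγ.continuousOn.aemeasurable measurableSet_Icc
  rw [← lintegral_map' hh.aemeasurable hγm]
  refine lintegral_mono' (Measure.le_iff.2 fun s hs => ?_) le_rfl
  rw [Measure.map_apply_of_aemeasurable hγm hs, Measure.restrict_apply hs]
  have hsub : s ∩ uIcc (γ 0) (γ l) ⊆ γ '' (γ ⁻¹' s ∩ Icc 0 l) := by
    rintro x ⟨hxs, hx⟩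
    obtain ⟨t, ht, rfl⟩ := intermediate_value_uIcc (a := 0) (b := l)
      (by rw [uIcc_of_le hl]; exact hγ.continuousOn) hx
    rw [uIcc_of_le hl] at ht
    exact ⟨t, ⟨hxs, ht⟩, rfl⟩
  calc volume (s ∩ uIcc (γ 0) (γ l)) ≤ volume (γ '' (γ ⁻¹' s ∩ Icc 0 l)) := measure_mono hsub
    _ ≤ volume (γ ⁻¹' s ∩ Icc 0 l) := by
        have := (hγ.mono (inter_subset_right (s := γ ⁻¹' s))).hausdorffMeasure_image_le
          zero_le_one
        simpa [hausdorffMeasure_real] using this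
    _ ≤ volume.restrict (Icc 0 l) (γ ⁻¹' s) := Measure.le_restrict_apply _ _

namespace NewtonianSpace

theorem isCurveIn_add_left {E : Set ℝ} {x y : ℝ} (hxy : x < y) (hE : Icc x y ⊆ E) :
    IsCurveIn E (fun t => x + t) (y - x) := by
  refine ⟨sub_pos.2 hxy, fun t ht => hE ⟨by linarith [ht.1], by linarith [ht.2]⟩, ?_⟩
  intro s hs t ht
  have hm : MonotoneOn (fun t : ℝ => x + t) (Icc 0 (y - x)) := fun a _ b _ hab => by
    simpa using hab
  rw [hm.eVariationOn_eq hs ht]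
  simp

theorem arcIntegral_add_left (g : ℝ → ℝ≥0∞) (x y : ℝ) :
    arcIntegral g (fun t => x + t) (y - x) = ∫⁻ t in Icc x y, g t := by
  have he : MeasurableEmbedding (fun t : ℝ => x + t) := measurableEmbedding_addLeft x
  rw [← (measurePreserving_add_left volume x).setLIntegral_comp_preimage_emb he g (Icc x y)]
  simp [arcIntegral]

theorem _root_.HasUnitSpeedOn.lipschitzOnWith {γ : ℝ → ℝ} {s : Set ℝ} (h : HasUnitSpeedOn γ s) :
    LipschitzOnWith 1 γ s := by
  have key : ∀ x ∈ s, ∀ y ∈ s, x ≤ y → edist (γ x) (γ y) ≤ edist x y := by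
    intro x hx y hy hxy
    calc edist (γ x) (γ y) ≤ eVariationOn γ (s ∩ Icc x y) :=
          eVariationOn.edist_le γ ⟨hx, left_mem_Icc.2 hxy⟩ ⟨hy, right_mem_Icc.2 hxy⟩
      _ = edist x y := by
          rw [h hx hy, edist_comm, edist_dist, Real.dist_eq, abs_of_nonneg (sub_nonneg.2 hxy)]
          simp
  intro x hx y hy
  rw [ENNReal.coe_one, one_mul]
  rcases le_total x y with hxy | hxy
  · exact key x hx y hy hxy
  · rw [edist_comm, edist_comm x]
    exact key y hy x hx hxy

theorem abs_coe_sub_coe (x y : ℝ) : ((x : EReal) - y).abs = ENNReal.ofReal |x - y| := by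
  rw [← EReal.coe_sub, EReal.abs_def]

theorem finite_of_abs_sub_ne_top {x y : EReal} (h : (x - y).abs ≠ ∞) :
    (x ≠ ⊤ ∧ x ≠ ⊥) ∧ (y ≠ ⊤ ∧ y ≠ ⊥) := by
  induction x <;> induction y <;> simp_all

theorem MemLpOn.mono {X : Type*} [MetricSpace X] [MeasurableSpace X] {g : X → ℝ≥0∞} {p : ℝ}
    {μ : Measure X} {E F : Set X} (h : MemLpOn g p μ E) (hFE : F ⊆ E) : MemLpOn g p μ F :=
  MemLp.mono_measure (Measure.restrict_mono hFE le_rfl) h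

/-- Hölder's inequality: on a set where the dual weight is integrable, `L^p` with respect to the
weighted measure is contained in the unweighted `L^1`. -/
theorem MemLpOn.lintegral_ne_top {p : ℝ} (hp : 1 < p) {μ : Measure ℝ} {w : ℝ → ℝ≥0∞} {s : Set ℝ}
    (hμ : μ.restrict s = (volume.restrict s).withDensity w)
    (hw : AEMeasurable w (volume.restrict s))
    (hw0 : ∀ᵐ x ∂(volume.restrict s), w x ≠ 0 ∧ w x ≠ ∞)
    (hw' : ∫⁻ x in s, w x ^ (1 / (1 - p)) ≠ ∞) {g : ℝ → ℝ≥0∞} (hg : MemLpOn g p μ s) :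
    AEMeasurable g (volume.restrict s) ∧ ∫⁻ x in s, g x ≠ ∞ := by
  have hp0 : 0 < p := by linarith
  have hac : volume.restrict s ≪ μ.restrict s := by
    rw [hμ]
    exact withDensity_absolutelyContinuous' hw (hw0.mono fun x hx => hx.1)
  have hgm : AEMeasurable g (volume.restrict s) := hg.1.aemeasurable.mono_ac hac
  refine ⟨hgm, ?_⟩
  have hgp : ∫⁻ x in s, w x * g x ^ p ≠ ∞ := by
    have := (eLpNorm_lt_top_iff_lintegral_rpow_enorm_lt_top (by simpa using hp0)
      ENNReal.ofReal_ne_top).1 hg.2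
    rw [ENNReal.toReal_ofReal hp0.le, hμ,
      lintegral_withDensity_eq_lintegral_mul₀ hw (by simpa using hgm.pow_const p)] at this
    simpa using this.ne
  have hpq : p.HolderConjugate (p / (p - 1)) := Real.HolderConjugate.conjExponent hp
  have key := ENNReal.lintegral_mul_le_Lp_mul_Lq (volume.restrict s) hpq
    (f := fun x => g x * w x ^ (1 / p)) (g := fun x => w x ^ (-(1 / p)))
    (hgm.mul (hw.pow_const _)) (hw.pow_const _)
  have e1 : ∫⁻ x in s, ((fun x => g x * w x ^ (1 / p)) * fun x => w x ^ (-(1 / p))) x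
      = ∫⁻ x in s, g x := by
    refine lintegral_congr_ae (hw0.mono fun x hx => ?_)
    simp only [Pi.mul_apply]
    rw [mul_assoc, ← ENNReal.rpow_add _ _ hx.1 hx.2, add_neg_cancel, ENNReal.rpow_zero, mul_one]
  have e2 : ∫⁻ x in s, (g x * w x ^ (1 / p)) ^ p = ∫⁻ x in s, w x * g x ^ p := by
    refine lintegral_congr fun x => ?_
    rw [ENNReal.mul_rpow_of_nonneg _ _ hp0.le, ← ENNReal.rpow_mul, one_div,
      inv_mul_cancel₀ hp0.ne', ENNReal.rpow_one, mul_comm]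
  have e3 : ∫⁻ x in s, (w x ^ (-(1 / p))) ^ (p / (p - 1)) = ∫⁻ x in s, w x ^ (1 / (1 - p)) := by
    refine lintegral_congr fun x => ?_
    rw [← ENNReal.rpow_mul]
    congr 1
    have h1 : p - 1 ≠ 0 := by linarith
    have h2 : 1 - p ≠ 0 := by linarith
    field_simp
    ring
  rw [e1, e2, e3] at key
  refine ne_top_of_le_ne_top (ENNReal.mul_ne_top ?_ ?_) key
  · exact ENNReal.rpow_ne_top_of_nonneg (by positivity) hgp
  · exact ENNReal.rpow_ne_top_of_nonneg hpq.symm.one_div_nonneg hw'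

/-- The modulus of the derivative of a locally absolutely continuous function is an upper
gradient. -/
theorem LocallyAbsolutelyContinuousOn.upperGradientIneq {I : Set ℝ} (hI : I.OrdConnected)
    {v : ℝ → ℝ} (hv : LocallyAbsolutelyContinuousOn v I) {u : ℝ → EReal}
    (hu : ∀ x ∈ I, u x = v x) {γ : ℝ → ℝ} {l : ℝ} (hγ : IsCurveIn I γ l) :
    UpperGradientIneq u (fun x => ‖deriv v x‖ₑ) γ l := by
  obtain ⟨hl, hmaps, hspeed⟩ := hγ
  have h0 : γ 0 ∈ I := hmaps (left_mem_Icc.2 hl.le)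
  have h1 : γ l ∈ I := hmaps (right_mem_Icc.2 hl.le)
  unfold UpperGradientIneq
  rw [hu _ h0, hu _ h1, abs_coe_sub_coe]
  refine le_trans ?_ (hspeed.lipschitzOnWith.setLIntegral_uIcc_le hl.le
    (measurable_deriv v).enorm)
  have key : ∀ x ∈ I, ∀ y ∈ I, x ≤ y →
      ENNReal.ofReal |v x - v y| ≤ ∫⁻ t in uIcc x y, ‖deriv v t‖ₑ := by
    intro x hx y hy hxy
    rw [uIcc_of_le hxy, abs_sub_comm, ← (hv x y hxy (hI.out hx hy)).integral_deriv_eq_sub,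
      intervalIntegral.integral_of_le hxy, ← integral_Icc_eq_integral_Ioc,
      ← Real.enorm_eq_ofReal_abs]
    exact enorm_integral_le_lintegral_enorm _
  rcases le_total (γ 0) (γ l) with h | h
  · exact key _ h0 _ h1 h
  · rw [abs_sub_comm, uIcc_comm]
    exact key _ h1 _ h0 h

end NewtonianSpace

theorem proposition1p3
    (p : ℝ) (hp : 1 < p)
    -- a nondegenerate interval, which may be open, closed, half-open, bounded or unbounded
    (I : Set ℝ) (hI : I.OrdConnected) (hI' : I.Nontrivial)
    (μ : Measure ℝ) (w : ℝ → ℝ≥0∞)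
    (hμ : μ.restrict I = (volume.restrict I).withDensity w)
    (hw : LocallyIntegrableOn w I volume)
    -- in `ℝ≥0∞`, `0 ^ (1 / (1 - p)) = ∞`
    (hw' : LocallyIntegrableOn (fun x => w x ^ (1 / (1 - p))) I volume)
    (u : ℝ → EReal) (hu : NewtonianSpace.MemNewtonianLoc u p μ I) :
    ∃ v : ℝ → ℝ,
      -- `u` is real-valued and locally absolutely continuous on `I`
      (∀ x ∈ I, u x = (v x : EReal)) ∧
      NewtonianSpace.LocallyAbsolutelyContinuousOn v I ∧
      -- `u'` exists a.e. on `I`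
      (∀ᵐ x ∂(volume.restrict I), DifferentiableAt ℝ v x) ∧
      -- `|u'|` is a minimal `p`-weak upper gradient of `u`
      NewtonianSpace.IsMinimalPWeakUpperGradientOn u (fun x => ‖deriv v x‖ₑ) p μ I ∧
      -- and every minimal `p`-weak upper gradient of `u` equals `|u'|` a.e. on `I`
      ∀ g : ℝ → ℝ≥0∞, NewtonianSpace.IsMinimalPWeakUpperGradientOn u g p μ I →
        ∀ᵐ x ∂(volume.restrict I), g x = ‖deriv v x‖ₑ := by
  have hIm : MeasurableSet I := hI.measurableSet
  have hwI : AEMeasurable w (volume.restrict I) := hw.aestronglyMeasurable.aemeasurable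
  have hw0 : ∀ᵐ x ∂(volume.restrict I), w x ≠ 0 ∧ w x ≠ ∞ := by
    have h1 : ∀ᵐ x ∂(volume.restrict I), w x < ∞ := by
      refine ae_restrict_of_forall_nhdsWithin hIm fun x hx => ?_
      obtain ⟨t, ht, hint⟩ := hw x hx
      exact ⟨t, ht, ae_lt_top' hint.1.aemeasurable (by simpa using hint.2.ne)⟩
    have h2 : ∀ᵐ x ∂(volume.restrict I), w x ^ (1 / (1 - p)) < ∞ := by
      refine ae_restrict_of_forall_nhdsWithin hIm fun x hx => ?_
      obtain ⟨t, ht, hint⟩ := hw' x hx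
      exact ⟨t, ht, ae_lt_top' hint.1.aemeasurable (by simpa using hint.2.ne)⟩
    filter_upwards [h1, h2] with x hx1 hx2
    refine ⟨fun h => ?_, hx1.ne⟩
    rw [h, ENNReal.zero_rpow_of_neg (one_div_neg.2 (by linarith))] at hx2
    exact lt_irrefl _ hx2
  have hac : volume.restrict I ≪ μ.restrict I := by
    rw [hμ]
    exact withDensity_absolutelyContinuous' hwI (hw0.mono fun x hx => hx.1)
  have hac' : μ.restrict I ≪ volume.restrict I := by
    rw [hμ]
    exact withDensity_absolutelyContinuous _ _
  have hac_sub : ∀ s ⊆ I, μ.restrict s ≪ volume.restrict s := by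
    intro s hs
    have := hac'.restrict s
    rwa [Measure.restrict_restrict_of_subset hs, Measure.restrict_restrict_of_subset hs] at this
  have hol : ∀ a b, Icc a b ⊆ I → ∀ g : ℝ → ℝ≥0∞, NewtonianSpace.MemLpOn g p μ (Icc a b) →
      AEMeasurable g (volume.restrict (Icc a b)) ∧ ∫⁻ x in Icc a b, g x ≠ ∞ := by
    intro a b hab g hg
    refine hg.lintegral_ne_top hp ?_ (hwI.mono_set hab)
      (ae_mono (Measure.restrict_mono hab le_rfl) hw0) ?_
    · rw [← Measure.restrict_restrict_of_subset hab, hμ, restrict_withDensity measurableSet_Icc,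
        Measure.restrict_restrict_of_subset hab]
    · have := (hw'.integrableOn_compact_subset hab isCompact_Icc).2
      simpa using this.ne
  have hloc : ∀ x ∈ I, ∃ a b, a < b ∧ x ∈ Icc a b ∧ Icc a b ⊆ I ∧ Icc a b ∈ 𝓝[I] x ∧
      ∃ g : ℝ → ℝ≥0∞, NewtonianSpace.MemLpOn g p μ (Icc a b) ∧
        ∀ s ∈ Icc a b, ∀ t ∈ Icc a b, s < t → (u s - u t).abs ≤ ∫⁻ y in Icc s t, g y := by
    intro x hx
    obtain ⟨r, hr, -, -, g, hg, hgp⟩ := hu x hx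
    obtain ⟨a, b, hab, hxab, hsub, hsub', hnhds⟩ := hI.exists_Icc_mem_nhdsWithin hI' hx
      (inter_mem (mem_nhdsWithin_of_mem_nhds (Metric.ball_mem_nhds x hr)) self_mem_nhdsWithin)
    refine ⟨a, b, hab, hxab, hsub, hnhds, g, hgp.mono hsub', fun s hs t ht hst => ?_⟩
    have := hg.2 _ _ (NewtonianSpace.isCurveIn_add_left hst
      ((Icc_subset_Icc hs.1 ht.2).trans hsub'))
    unfold NewtonianSpace.UpperGradientIneq at this
    rw [NewtonianSpace.arcIntegral_add_left] at this
    simpa using this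
  have hfin : ∀ x ∈ I, u x ≠ ⊤ ∧ u x ≠ ⊥ := by
    intro x hx
    obtain ⟨a, b, hab, hxab, hsub, -, g, hg, hgu⟩ := hloc x hx
    have hne : ∀ s ∈ Icc a b, ∀ t ∈ Icc a b, s < t → (u s - u t).abs ≠ ∞ := fun s hs t ht hst =>
      ne_top_of_le_ne_top (hol a b hsub g hg).2
        ((hgu s hs t ht hst).trans (lintegral_mono_set (Icc_subset_Icc hs.1 ht.2)))
    rcases hxab.2.lt_or_eq with h | h
    · exact (NewtonianSpace.finite_of_abs_sub_ne_top
        (hne x hxab b (right_mem_Icc.2 hab.le) h)).1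
    · exact (NewtonianSpace.finite_of_abs_sub_ne_top
        (hne a (left_mem_Icc.2 hab.le) x hxab (h ▸ hab))).2
  set v : ℝ → ℝ := fun x => (u x).toReal with hv
  have huv : ∀ x ∈ I, u x = (v x : EReal) := fun x hx =>
    (EReal.coe_toReal (hfin x hx).1 (hfin x hx).2).symm
  have hftc : ∀ a b, a ≤ b → Icc a b ⊆ I → ∀ g : ℝ → ℝ≥0∞,
      NewtonianSpace.MemLpOn g p μ (Icc a b) →
      (∀ s ∈ Icc a b, ∀ t ∈ Icc a b, s < t → (u s - u t).abs ≤ ∫⁻ y in Icc s t, g y) →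
      AbsolutelyContinuousOnInterval v a b ∧
        ∀ᵐ x ∂(volume.restrict (Icc a b)), ‖deriv v x‖ₑ ≤ g x := by
    intro a b hab hsub g hg hgu
    refine absolutelyContinuousOnInterval_and_enorm_deriv_le hab (hol a b hsub g hg).1
      (hol a b hsub g hg).2 fun s hs t ht hst => ?_
    rw [← NewtonianSpace.abs_coe_sub_coe, ← huv s (hsub hs), ← huv t (hsub ht)]
    exact hgu s hs t ht hst
  have hAC : NewtonianSpace.LocallyAbsolutelyContinuousOn v I := by
    intro c d hcd hcdI
    refine AbsolutelyContinuousOnInterval.of_forall_nhdsWithin (fun x hx => ?_) hcd hcdI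
    obtain ⟨a, b, hab, -, hsub, hnhds, g, hg, hgu⟩ := hloc x hx
    exact ⟨a, b, hab.le, hnhds, (hftc a b hab.le hsub g hg hgu).1⟩
  have hdm : Measurable fun x => ‖deriv v x‖ₑ := (measurable_deriv v).enorm
  have hweak : NewtonianSpace.IsPWeakUpperGradientOn u (fun x => ‖deriv v x‖ₑ) p μ I :=
    ⟨hdm.aemeasurable, 0, measurable_const, MemLp.zero, fun γ l hγ hfail =>
      absurd (hAC.upperGradientIneq hI huv hγ) hfail⟩
  have hLp : NewtonianSpace.MemLpLocOn (fun x => ‖deriv v x‖ₑ) p μ I := by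
    intro x hx
    obtain ⟨a, b, hab, -, hsub, hnhds, g, hg, hgu⟩ := hloc x hx
    obtain ⟨r, hr, hrt⟩ := Metric.mem_nhdsWithin_iff.1 hnhds
    refine ⟨r, hr, NewtonianSpace.MemLpOn.mono ?_ hrt⟩
    refine MemLp.of_le_enorm hg hdm.aestronglyMeasurable ?_
    filter_upwards [(hac_sub _ hsub).ae_le (hftc a b hab.le hsub g hg hgu).2]
      with y hy
    simpa using hy
  have hmin : ∀ g' : ℝ → ℝ≥0∞, NewtonianSpace.IsPWeakUpperGradientOn u g' p μ I →
      NewtonianSpace.MemLpLocOn g' p μ I → ∀ᵐ x ∂(volume.restrict I), ‖deriv v x‖ₑ ≤ g' x := by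
    rintro g' ⟨-, ρ, -, hρ, hρu⟩ hg'
    refine ae_restrict_of_forall_nhdsWithin hIm fun x hx => ?_
    obtain ⟨r, hr, hgr⟩ := hg' x hx
    obtain ⟨a, b, hab, hxab, hsub, hsub', hnhds⟩ := hI.exists_Icc_mem_nhdsWithin hI' hx
      (inter_mem (mem_nhdsWithin_of_mem_nhds (Metric.ball_mem_nhds x hr)) self_mem_nhdsWithin)
    refine ⟨_, hnhds, (hftc a b hab.le hsub g' (hgr.mono hsub') fun s hs t ht hst => ?_).2⟩
    have hst' : Icc s t ⊆ I := (Icc_subset_Icc hs.1 ht.2).trans hsub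
    by_contra hcon
    have := hρu _ _ (NewtonianSpace.isCurveIn_add_left hst hst') (by
      unfold NewtonianSpace.UpperGradientIneq
      rw [NewtonianSpace.arcIntegral_add_left]
      simpa using hcon)
    rw [NewtonianSpace.arcIntegral_add_left] at this
    exact (hol s t hst' ρ (hρ.mono hst')).2 this
  refine ⟨v, huv, hAC, ?_, ⟨hweak, hLp, fun g' hg' hg'p => hac' (hmin g' hg' hg'p)⟩, ?_⟩
  · refine ae_restrict_of_forall_nhdsWithin hIm fun x hx => ?_
    obtain ⟨a, b, hab, -, hsub, hnhds, -⟩ := hloc x hx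
    refine ⟨_, hnhds, (ae_restrict_iff' measurableSet_Icc).2 ?_⟩
    have := (hAC a b hab.le hsub).ae_differentiableAt
    rwa [uIcc_of_le hab.le] at this
  · rintro g ⟨hgw, hgp, hgmin⟩
    filter_upwards [hmin g hgw hgp, hac (hgmin _ hweak hLp)] with x h1 h2
    exact le_antisymm h2 h1
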